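/- Let $d \ge 1$ be an integer. The \emph{pellytope} is the Newton polytope \[ \mathcal P_d := \mathrm{Newt}\Big(\prod_{i=1}^{d}(1+y_i)\,\prod_{j=1}^{d-1}(1+y_j+y_jy_{j+1})\Big) \subset \mathbb R^d , \] that is, the convex hull of the exponent vectors of all monomials occurring with nonzero coefficient in this polynomial in the variables $y_1,\dots,y_d$. The Pell numbers are defined by $n_1=1$, $n_2=2$ and $n_k = 2n_{k-1}+n_{k-2}$ for $k \ge 3$. Then $\mathcal P_d$ is a simple polytope of dimension $d$ (simple meaning that every vertex lies in exactly $d$ facets), and it has exactly $3d-1$ facets and exactly $n_{d+1}$ vertices. -/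

import Mathlib

noncomputable section

/-- The Newton polytope of a polynomial in `d` variables: the convex hull in `ℝ^d` of the
exponent vectors of the monomials that occur with a nonzero coefficient. -/
def newtonPolytope {d : ℕ} {R : Type*} [CommSemiring R] (f : MvPolynomial (Fin d) R) :
    Set (Fin d → ℝ) :=
  convexHull ℝ ((fun (m : Fin d →₀ ℕ) (i : Fin d) => (m i : ℝ)) '' (f.support : Set (Fin d →₀ ℕ)))

/-- The polynomial `∏_{i=1}^{d} (1 + y_i) * ∏_{j=1}^{d-1} (1 + y_j + y_j y_{j+1})`, with the
variables numbered from `0` to `d - 1`. -/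
def pellPolynomial (d : ℕ) : MvPolynomial (Fin d) ℤ :=
  (∏ i : Fin d, (1 + MvPolynomial.X i)) *
    ∏ j : Fin (d - 1),
      (1 + MvPolynomial.X (⟨j.val, by omega⟩ : Fin d)
        + MvPolynomial.X (⟨j.val, by omega⟩ : Fin d)
          * MvPolynomial.X (⟨j.val + 1, by omega⟩ : Fin d))

/-- The pellytope in `ℝ^d`. -/
def pellytope (d : ℕ) : Set (Fin d → ℝ) :=
  newtonPolytope (pellPolynomial d)

/-- Pell's numbers `n_1 = 1`, `n_2 = 2`, `n_k = 2 n_{k-1} + n_{k-2}`, extended by `n_0 = 0`. -/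
def pellNumber : ℕ → ℕ
  | 0 => 0
  | 1 => 1
  | k + 2 => 2 * pellNumber (k + 1) + pellNumber k

section Polytope

variable {E : Type*} [AddCommGroup E] [Module ℝ E] [TopologicalSpace E]

/-- A polytope is the convex hull of a nonempty finite set of points. -/
def IsPolytope (P : Set E) : Prop :=
  ∃ s : Finset E, s.Nonempty ∧ P = convexHull ℝ (s : Set E)

/-- The dimension of a nonempty convex set, that is, of its affine hull. -/
def convexDim (P : Set E) : ℕ :=
  Module.finrank ℝ (vectorSpan ℝ P)

/-- The facets of `P`: the nonempty faces (sets of maximizers over `P` of a linear functional) of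
dimension `dim P - 1`. -/
def polytopeFacets (P : Set E) : Set (Set E) :=
  {F | F.Nonempty ∧ IsExposed ℝ P F ∧ convexDim F + 1 = convexDim P}

/-- The vertices of `P`: the points `v` such that `{v}` is a face of `P`. -/
def polytopeVertices (P : Set E) : Set E :=
  {v | IsExposed ℝ P {v}}

/-- A polytope is simple if every vertex lies on exactly `dim P` facets. -/
def IsSimplePolytope (P : Set E) : Prop :=
  IsPolytope P ∧
    ∀ v ∈ polytopeVertices P,
      {F | F ∈ polytopeFacets P ∧ v ∈ F}.Finite ∧
        {F | F ∈ polytopeFacets P ∧ v ∈ F}.ncard = convexDim P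

end Polytope

end

/-! The proof determines the normal fan. Every functional `u` is maximized factor by factor. The
factors `1 + y_i` see the sign of `u_i`. The trinomials matter further only where `u_j ≤ 0 <
u_{j+1}`, and there they compare `u_j + u_{j+1}` with `0`. So each orthant is cut by one hyperplane
at every ascent from nonpositive to positive; distinct ascents share no coordinate, hence the pieces
are simplicial cones. Their generators are the `3d - 1` vectors `e_i`, `-e_i`, `e_{j+1} - e_j`, and
the cones correspond to words in four letters with local transition rules, which the Pell recursion
counts.

For a complete simplicial fan whose cones are tight at distinct points of `P`, with all other
inequalities strict there, rays are facets, cones are vertices, and `P` is simple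
(`polytopeFacets_eq`, `polytopeVertices_eq`, `isSimplePolytope`). Completeness is
`sum_mul_nonneg_of_pellWord`. The polyhedron is the Newton polytope because all exponents satisfy
the inequalities and every functional is maximized at an exponent (`exponents_le`,
`pellVert_mem_support`). -/

/-! ### Polyhedra with a complete simplicial normal fan -/

section NormalFan

variable {E : Type*} [NormedAddCommGroup E] [NormedSpace ℝ E]

/-- The data of a simplicial normal fan for a set `P`: outer normals `ray a` with right-hand sides
`h a`, maximal cones spanned by `ray (cone k j)`, the basis `b k` dual to such a cone, and the
point `vert k` of `P` belonging to it. -/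
structure SimplicialNormalFan (P : Set E) (ι κ J : Type*) [DecidableEq J] where
  ray : ι → E →L[ℝ] ℝ
  h : ι → ℝ
  cone : κ → J → ι
  vert : κ → E
  b : κ → J → E
  eq_halfSpaces : P = {x | ∀ a, ray a x ≤ h a}
  ray_b : ∀ k i j, ray (cone k i) (b k j) = if i = j then 1 else 0
  complete : ∀ u : E →L[ℝ] ℝ, ∃ k, ∀ j, 0 ≤ u (b k j)
  tight : ∀ k j, ray (cone k j) (vert k) = h (cone k j)
  strict : ∀ k a, a ∉ Set.range (cone k) → ray a (vert k) < h a
  exists_cone : ∀ a, ∃ k j, cone k j = a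
  vert_injective : Function.Injective vert

namespace SimplicialNormalFan

variable {P : Set E} {ι κ J : Type*} [DecidableEq J]
  (D : SimplicialNormalFan P ι κ J)

theorem mem_iff {x : E} : x ∈ P ↔ ∀ a, D.ray a x ≤ D.h a := by
  conv_lhs => rw [D.eq_halfSpaces]
  rfl

theorem vert_mem (k : κ) : D.vert k ∈ P := by
  rw [D.mem_iff]
  intro a
  by_cases ha : a ∈ Set.range (D.cone k)
  · obtain ⟨j, rfl⟩ := ha
    exact (D.tight k j).le
  · exact (D.strict k a ha).le

theorem cone_injective (k : κ) : Function.Injective (D.cone k) := by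
  intro i j hij
  by_contra hne
  have h1 := D.ray_b k i j
  rw [hij, D.ray_b] at h1
  simp [hne] at h1

theorem linearIndependent_b [Fintype J] (k : κ) : LinearIndependent ℝ (D.b k) := by
  rw [Fintype.linearIndependent_iff]
  intro g hg i
  have := congrArg (D.ray (D.cone k i)) hg
  simpa [D.ray_b] using this

variable [Fintype J] (hJ : Fintype.card J = Module.finrank ℝ E)

include hJ in
theorem span_b [FiniteDimensional ℝ E] (k : κ) : Submodule.span ℝ (Set.range (D.b k)) = ⊤ :=
  (D.linearIndependent_b k).span_eq_top_of_card_eq_finrank' hJ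

include hJ in
theorem sum_ray_smul_b [FiniteDimensional ℝ E]
    (k : κ) (x : E) : ∑ j, D.ray (D.cone k j) x • D.b k j = x := by
  have hx : x ∈ Submodule.span ℝ (Set.range (D.b k)) := by simp [D.span_b hJ k]
  obtain ⟨c, rfl⟩ := (Submodule.mem_span_range_iff_exists_fun ℝ).1 hx
  simp [D.ray_b]

include hJ in
theorem functional_eq_sum [FiniteDimensional ℝ E] (k : κ) (u : E →L[ℝ] ℝ) (x : E) :
    u x = ∑ j, u (D.b k j) * D.ray (D.cone k j) x := by
  conv_lhs => rw [← D.sum_ray_smul_b hJ k x]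
  simp [mul_comm]

include hJ in
-- In the dual basis, `u` is a nonnegative combination of the rays of cone `k`, and each of these is
-- maximal at `vert k`.
theorem functional_le_vert [FiniteDimensional ℝ E]
    {k : κ} {u : E →L[ℝ] ℝ} (hu : ∀ j, 0 ≤ u (D.b k j)) {x : E}
    (hx : x ∈ P) : u x ≤ u (D.vert k) := by
  rw [D.functional_eq_sum hJ k u x, D.functional_eq_sum hJ k u (D.vert k)]
  refine Finset.sum_le_sum fun j _ => mul_le_mul_of_nonneg_left ?_ (hu j)
  rw [D.tight]
  exact D.mem_iff.1 hx _

include hJ in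
theorem functional_eq_vert_iff [FiniteDimensional ℝ E]
    {k : κ} {u : E →L[ℝ] ℝ} (hu : ∀ j, 0 ≤ u (D.b k j)) {x : E}
    (hx : x ∈ P) :
    u x = u (D.vert k) ↔
      ∀ j, 0 < u (D.b k j) → D.ray (D.cone k j) x = D.h (D.cone k j) := by
  rw [D.functional_eq_sum hJ k u x, D.functional_eq_sum hJ k u (D.vert k),
    Finset.sum_eq_sum_iff_of_le]
  · refine ⟨fun H j hj => ?_, fun H j _ => ?_⟩
    · rw [← D.tight]
      exact mul_left_cancel₀ hj.ne' (H j (Finset.mem_univ j))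
    · rcases (hu j).eq_or_lt with h0 | h0
      · simp [← h0]
      · rw [H j h0, D.tight]
  · refine fun j _ => mul_le_mul_of_nonneg_left ?_ (hu j)
    rw [D.tight]
    exact D.mem_iff.1 hx _

include hJ in
theorem exposed_eq [FiniteDimensional ℝ E] {k : κ} {u : E →L[ℝ] ℝ} (hu : ∀ j, 0 ≤ u (D.b k j)) :
    {x ∈ P | ∀ y ∈ P, u y ≤ u x} =
      {x ∈ P | ∀ j, 0 < u (D.b k j) → D.ray (D.cone k j) x = D.h (D.cone k j)} := by
  ext x
  refine and_congr_right fun hx => ?_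
  rw [← D.functional_eq_vert_iff hJ hu hx]
  exact ⟨fun H => (D.functional_le_vert hJ hu hx).antisymm (H _ (D.vert_mem k)),
    fun H y hy => H ▸ D.functional_le_vert hJ hu hy⟩

include hJ in
theorem isExposed_vert [FiniteDimensional ℝ E] (k : κ) : IsExposed ℝ P {D.vert k} := by
  intro _
  -- The sum of the generators is interior to the cone, so its maximizers make all of them tight,
  -- which determines the point.
  let u : E →L[ℝ] ℝ := ∑ j, D.ray (D.cone k j)
  have hu1 : ∀ j, u (D.b k j) = 1 := fun j => by simp [u, D.ray_b]
  have hu : ∀ j, 0 ≤ u (D.b k j) := fun j => by simp [hu1]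
  refine ⟨u, ?_⟩
  rw [D.exposed_eq hJ hu]
  ext x
  simp only [Set.mem_singleton_iff, Set.mem_ofPred_eq, hu1, zero_lt_one, true_imp_iff]
  refine ⟨?_, fun ⟨_, H⟩ => ?_⟩
  · rintro rfl
    exact ⟨D.vert_mem k, D.tight k⟩
  · rw [← D.sum_ray_smul_b hJ k x, ← D.sum_ray_smul_b hJ k (D.vert k)]
    simp only [H, D.tight]

include hJ in
theorem polytopeVertices_eq [FiniteDimensional ℝ E] : polytopeVertices P = Set.range D.vert := by
  ext v
  refine ⟨fun hv => ?_, ?_⟩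
  · obtain ⟨u, hu⟩ := hv (Set.singleton_nonempty v)
    obtain ⟨k, hk⟩ := D.complete u
    have : D.vert k ∈ ({v} : Set E) := by
      rw [hu]
      exact ⟨D.vert_mem k, fun y hy => D.functional_le_vert hJ hk hy⟩
    exact ⟨k, this⟩
  · rintro ⟨k, rfl⟩
    exact D.isExposed_vert hJ k

/-- The face of `P` on which the inequality belonging to `a` is tight. -/
def facet (a : ι) : Set E := {x ∈ P | D.ray a x = D.h a}

omit [Fintype J] in
theorem vert_mem_facet_iff {k : κ} {a : ι} :
    D.vert k ∈ D.facet a ↔ a ∈ Set.range (D.cone k) := by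
  constructor
  · intro H
    by_contra hne
    exact (D.strict k a hne).ne H.2
  · rintro ⟨j, rfl⟩
    exact ⟨D.vert_mem k, D.tight k j⟩

omit [Fintype J] in
theorem facet_nonempty (a : ι) : (D.facet a).Nonempty := by
  obtain ⟨k, j, hj⟩ := D.exists_cone a
  exact ⟨D.vert k, D.vert_mem_facet_iff.2 ⟨j, hj⟩⟩

omit [Fintype J] in
theorem isExposed_facet (a : ι) : IsExposed ℝ P (D.facet a) := by
  intro _
  refine ⟨D.ray a, ?_⟩
  obtain ⟨x, hx⟩ := D.facet_nonempty a
  ext y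
  refine and_congr_right fun hy => ?_
  exact ⟨fun H z hz => H ▸ D.mem_iff.1 hz a,
    fun H => (D.mem_iff.1 hy a).antisymm (hx.2 ▸ H x hx.1)⟩

omit [Fintype J] in
-- Moving along `-b k j` lowers one tight ray and fixes the other tight ones; the remaining finitely
-- many inequalities have slack. These are the edge directions at the vertex.
theorem exists_sub_smul_mem [Finite ι] (k : κ) (j : J) :
    ∃ ε : ℝ, 0 < ε ∧ D.vert k - ε • D.b k j ∈ P := by
  have key : ∀ a, ∀ᶠ ε in nhdsWithin (0 : ℝ) (Set.Ioi 0),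
      D.ray a (D.vert k - ε • D.b k j) ≤ D.h a := by
    intro a
    by_cases ha : a ∈ Set.range (D.cone k)
    · obtain ⟨i, rfl⟩ := ha
      filter_upwards [self_mem_nhdsWithin] with ε hε
      have hε : 0 < ε := hε
      rw [map_sub, map_smul, D.tight, D.ray_b]
      split_ifs <;> simp [hε.le]
    · have hc : Continuous fun ε : ℝ => D.ray a (D.vert k - ε • D.b k j) := by fun_prop
      have h0 : (fun ε : ℝ => D.ray a (D.vert k - ε • D.b k j)) 0 < D.h a := by
        simpa using D.strict k a ha
      have := (hc.continuousAt (x := 0)).eventually (gt_mem_nhds h0)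
      exact (this.filter_mono nhdsWithin_le_nhds).mono fun _ => le_of_lt
  obtain ⟨ε, h1, h2⟩ := ((Filter.eventually_all.2 key).and self_mem_nhdsWithin).exists
  exact ⟨ε, h2, D.mem_iff.2 h1⟩

omit [Fintype J] in
theorem b_mem_vectorSpan [Finite ι] (k : κ) (j : J) : D.b k j ∈ vectorSpan ℝ P := by
  obtain ⟨ε, hε, hm⟩ := D.exists_sub_smul_mem k j
  have := vsub_mem_vectorSpan ℝ (D.vert_mem k) hm
  rw [vsub_eq_sub, sub_sub_cancel] at this
  exact (Submodule.smul_mem_iff _ hε.ne').1 this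

omit [Fintype J] in
theorem b_mem_vectorSpan_facet [Finite ι] (k : κ) {i j : J} (hij : i ≠ j) :
    D.b k j ∈ vectorSpan ℝ (D.facet (D.cone k i)) := by
  obtain ⟨ε, hε, hm⟩ := D.exists_sub_smul_mem k j
  have hm' : D.vert k - ε • D.b k j ∈ D.facet (D.cone k i) := by
    refine ⟨hm, ?_⟩
    rw [map_sub, map_smul, D.tight, D.ray_b, if_neg hij, smul_zero, sub_zero]
  have := vsub_mem_vectorSpan ℝ (D.vert_mem_facet_iff.2 ⟨i, rfl⟩) hm'
  rw [vsub_eq_sub, sub_sub_cancel] at this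
  exact (Submodule.smul_mem_iff _ hε.ne').1 this

omit [Fintype J] in
theorem ray_eq_zero_of_mem_vectorSpan {F : Set E} {a : ι} (hF : F ⊆ D.facet a) {x : E}
    (hx : x ∈ vectorSpan ℝ F) : D.ray a x = 0 := by
  have : vectorSpan ℝ F ≤ LinearMap.ker (D.ray a : E →ₗ[ℝ] ℝ) := by
    refine Submodule.span_le.2 ?_
    rintro _ ⟨y, hy, z, hz, rfl⟩
    simp [(hF hy).2, (hF hz).2]
  simpa using this hx

include D hJ in
theorem convexDim_eq [FiniteDimensional ℝ E] [Finite ι] (k : κ) : convexDim P = Fintype.card J := by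
  have : vectorSpan ℝ P = ⊤ := by
    rw [eq_top_iff, ← D.span_b hJ k, Submodule.span_le]
    rintro _ ⟨j, rfl⟩
    exact D.b_mem_vectorSpan k j
  rw [convexDim, this, finrank_top, hJ]

include hJ in
theorem convexDim_facet [FiniteDimensional ℝ E] [Finite ι]
    (a : ι) : convexDim (D.facet a) + 1 = Fintype.card J := by
  obtain ⟨k, i, rfl⟩ := D.exists_cone a
  -- The ray kills all directions of the facet but not `b k i`; conversely, the other edge
  -- directions at `vert k` lie in the facet.
  have hlt : convexDim (D.facet (D.cone k i)) < Fintype.card J := by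
    rw [hJ]
    refine Submodule.finrank_lt fun htop => ?_
    have := D.ray_eq_zero_of_mem_vectorSpan (subset_refl (D.facet (D.cone k i)))
      (x := D.b k i) (by simp [htop])
    simp [D.ray_b] at this
  have hge : Fintype.card {j // j ≠ i} ≤ convexDim (D.facet (D.cone k i)) := by
    have hli := (D.linearIndependent_b k).comp (Subtype.val : {j // j ≠ i} → J)
      Subtype.val_injective
    rw [← finrank_span_eq_card hli]
    refine Submodule.finrank_mono (Submodule.span_le.2 ?_)
    rintro _ ⟨⟨j, hj⟩, rfl⟩
    exact D.b_mem_vectorSpan_facet k hj.symm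
  have hc : Fintype.card {j // j ≠ i} = Fintype.card J - 1 := by simp
  omega

include hJ in
theorem polytopeFacets_eq [FiniteDimensional ℝ E] [Finite ι]
    : polytopeFacets P = Set.range D.facet := by
  ext F
  constructor
  · rintro ⟨hne, hexp, hdim⟩
    obtain ⟨u, rfl⟩ := hexp hne
    obtain ⟨k, hk⟩ := D.complete u
    rw [D.exposed_eq hJ hk] at hdim ⊢
    rw [D.convexDim_eq hJ k] at hdim
    set F := {x ∈ P | ∀ j, 0 < u (D.b k j) → D.ray (D.cone k j) x = D.h (D.cone k j)} with hF
    have hsub : ∀ j, 0 < u (D.b k j) → F ⊆ D.facet (D.cone k j) :=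
      fun j hj x hx => ⟨hx.1, hx.2 j hj⟩
    -- With exactly one positive coefficient the face is a facet of the fan. A second one puts it in
    -- two such facets and lowers the dimension too far; with none, the face is all of `P`.
    by_cases h0 : ∃ i, 0 < u (D.b k i)
    · obtain ⟨i, hi⟩ := h0
      refine ⟨D.cone k i, ((hsub i hi).antisymm fun x hx => ⟨hx.1, fun j hj => ?_⟩).symm⟩
      by_cases hij : i = j
      · exact hij ▸ hx.2
      · have hlt : vectorSpan ℝ F < vectorSpan ℝ (D.facet (D.cone k i)) := by
          refine (vectorSpan_mono ℝ (hsub i hi)).lt_of_not_ge fun hle => ?_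
          have := D.ray_eq_zero_of_mem_vectorSpan (hsub j hj)
            (hle (D.b_mem_vectorSpan_facet k hij))
          simp [D.ray_b] at this
        have h1 := Submodule.finrank_lt_finrank_of_lt hlt
        have h2 := D.convexDim_facet hJ (D.cone k i)
        simp only [convexDim] at h2 hdim
        omega
    · have hFP : F = P := by
        push Not at h0
        ext x
        exact ⟨fun hx => hx.1, fun hx => ⟨hx, fun j hj => absurd hj (h0 j).not_gt⟩⟩
      rw [hFP, D.convexDim_eq hJ k] at hdim
      omega
  · rintro ⟨a, rfl⟩
    obtain ⟨k, -⟩ := D.exists_cone a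
    exact ⟨D.facet_nonempty a, D.isExposed_facet a,
      by rw [D.convexDim_facet hJ, D.convexDim_eq hJ k]⟩

omit [Fintype J] in
theorem facet_injective [Finite ι] : Function.Injective D.facet := by
  intro a a' haa
  obtain ⟨k, i, rfl⟩ := D.exists_cone a
  have : D.vert k ∈ D.facet a' := haa ▸ D.vert_mem_facet_iff.2 ⟨i, rfl⟩
  obtain ⟨j, rfl⟩ := D.vert_mem_facet_iff.1 this
  by_contra hne
  have hij : i ≠ j := fun hij => hne (by rw [hij])
  have h1 := D.ray_eq_zero_of_mem_vectorSpan haa.subset (D.b_mem_vectorSpan_facet k hij)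
  simp [D.ray_b] at h1

include hJ in
theorem facets_through_vert [FiniteDimensional ℝ E] [Finite ι] (k : κ) :
    {F | F ∈ polytopeFacets P ∧ D.vert k ∈ F} = Set.range (D.facet ∘ D.cone k) := by
  rw [D.polytopeFacets_eq hJ]
  ext F
  constructor
  · rintro ⟨⟨a, rfl⟩, hv⟩
    obtain ⟨j, rfl⟩ := D.vert_mem_facet_iff.1 hv
    exact ⟨j, rfl⟩
  · rintro ⟨j, rfl⟩
    exact ⟨⟨_, rfl⟩, D.vert_mem_facet_iff.2 ⟨j, rfl⟩⟩

include D hJ in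
theorem isSimplePolytope [FiniteDimensional ℝ E] [Finite ι]
    (hP : IsPolytope P) : IsSimplePolytope P := by
  refine ⟨hP, fun v hv => ?_⟩
  rw [D.polytopeVertices_eq hJ] at hv
  obtain ⟨k, rfl⟩ := hv
  rw [D.facets_through_vert hJ, D.convexDim_eq hJ k]
  refine ⟨Set.finite_range _, ?_⟩
  rw [Set.ncard_range_of_injective (D.facet_injective.comp (D.cone_injective k)),
    Nat.card_eq_fintype_card]

include D hJ in
theorem ncard_polytopeFacets [FiniteDimensional ℝ E] [Finite ι] :
    (polytopeFacets P).Finite ∧ (polytopeFacets P).ncard = Nat.card ι := by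
  rw [D.polytopeFacets_eq hJ]
  exact ⟨Set.finite_range _, Set.ncard_range_of_injective D.facet_injective⟩

include D hJ in
theorem ncard_polytopeVertices [FiniteDimensional ℝ E] [Finite κ] :
    (polytopeVertices P).Finite ∧ (polytopeVertices P).ncard = Nat.card κ := by
  rw [D.polytopeVertices_eq hJ]
  exact ⟨Set.finite_range _, Set.ncard_range_of_injective D.vert_injective⟩

end SimplicialNormalFan

/-- The convex hull of a finite set that satisfies finitely many inequalities equals the
polyhedron cut out by them if every functional attains a common maximum in it. -/
theorem convexHull_eq_halfSpaces {ι : Type*} {s : Set E} (hs : s.Finite)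
    (ray : ι → E →L[ℝ] ℝ) (h : ι → ℝ) (hle : ∀ x ∈ s, ∀ a, ray a x ≤ h a)
    (hmax : ∀ u : E →L[ℝ] ℝ, ∃ v ∈ s, ∀ x, (∀ a, ray a x ≤ h a) → u x ≤ u v) :
    convexHull ℝ s = {x | ∀ a, ray a x ≤ h a} := by
  have hconv : Convex ℝ {x | ∀ a, ray a x ≤ h a} := by
    have : {x | ∀ a, ray a x ≤ h a} = ⋂ a, {x | ray a x ≤ h a} := by ext; simp
    rw [this]
    exact convex_iInter fun a => convex_halfSpace_le (ray a).isLinear (h a)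
  refine (convexHull_min hle hconv).antisymm fun x hx => ?_
  by_contra hxs
  -- A functional separating `x` from the hull would exceed its maximum over the polyhedron, which
  -- is attained in `s`.
  obtain ⟨u, c, h1, h2⟩ := geometric_hahn_banach_closed_point (convex_convexHull ℝ s)
    (hs.isClosed_convexHull ℝ) hxs
  obtain ⟨v, hv, hvx⟩ := hmax u
  exact absurd (hvx x hx) (not_le.2 ((h1 v (subset_convexHull ℝ s hv)).trans h2))

end NormalFan
-- Exponents of the Pell polynomial
section Support

open scoped Pointwise

/-- Over `ℕ` nothing cancels, so supports add as Minkowski sums. -/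
theorem MvPolynomial.support_mul_nat {σ : Type*} [DecidableEq σ] (f g : MvPolynomial σ ℕ) :
    ((f * g).support : Set (σ →₀ ℕ)) = f.support + g.support := by
  ext m
  simp only [Finset.mem_coe, MvPolynomial.mem_support_iff, MvPolynomial.coeff_mul, ne_eq,
    Finset.sum_eq_zero_iff, mul_eq_zero, Set.mem_add, Prod.forall]
  push Not
  constructor
  · rintro ⟨a, b, h, ha, hb⟩
    exact ⟨a, ha, b, hb, Finset.HasAntidiagonal.mem_antidiagonal.1 h⟩
  · rintro ⟨a, ha, b, hb, h⟩
    exact ⟨a, b, Finset.HasAntidiagonal.mem_antidiagonal.2 h, ha, hb⟩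

theorem MvPolynomial.support_add_nat {σ : Type*} [DecidableEq σ] (f g : MvPolynomial σ ℕ) :
    (f + g).support = f.support ∪ g.support := by
  ext m
  simp only [MvPolynomial.mem_support_iff, MvPolynomial.coeff_add, Finset.mem_union]
  omega

theorem MvPolynomial.support_prod_nat {σ τ : Type*} [DecidableEq σ] (t : Finset τ)
    (f : τ → MvPolynomial σ ℕ) :
    ((∏ i ∈ t, f i).support : Set (σ →₀ ℕ)) = ∑ i ∈ t, ((f i).support : Set (σ →₀ ℕ)) := by
  classical
  induction t using Finset.induction_on with
  | empty =>
    simp only [Finset.prod_empty, Finset.sum_empty]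
    rw [← MvPolynomial.C_1, ← MvPolynomial.monomial_zero', MvPolynomial.support_monomial]
    simp [Set.singleton_zero]
  | insert a t ha ih =>
    rw [Finset.prod_insert ha, Finset.sum_insert ha, MvPolynomial.support_mul_nat, ih]

theorem MvPolynomial.mem_support_one_add_X {σ : Type*} [DecidableEq σ] (i : σ) (m : σ →₀ ℕ) :
    m ∈ (1 + X i : MvPolynomial σ ℕ).support ↔ ∃ p ≤ 1, m = Finsupp.single i p := by
  rw [support_add_nat, ← C_1, ← monomial_zero', support_monomial, support_X]
  simp only [one_ne_zero, if_false, Finset.mem_union, Finset.mem_singleton]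
  constructor
  · rintro (rfl | rfl)
    · exact ⟨0, by simp, by simp⟩
    · exact ⟨1, le_rfl, rfl⟩
  · rintro ⟨p, hp, rfl⟩
    interval_cases p <;> simp

theorem MvPolynomial.mem_support_one_add_X_add_X_mul_X {σ : Type*} [DecidableEq σ] (i j : σ)
    (m : σ →₀ ℕ) :
    m ∈ (1 + X i + X i * X j : MvPolynomial σ ℕ).support ↔
      ∃ q r, r ≤ q ∧ q ≤ 1 ∧ m = Finsupp.single i q + Finsupp.single j r := by
  rw [support_add_nat, Finset.mem_union, mem_support_one_add_X, X, X, monomial_mul,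
    support_monomial]
  simp only [mul_one, one_ne_zero, if_false, Finset.mem_singleton]
  constructor
  · rintro (⟨p, hp, rfl⟩ | rfl)
    · exact ⟨p, 0, by omega, hp, by simp⟩
    · exact ⟨1, 1, le_rfl, le_rfl, rfl⟩
  · rintro ⟨q, r, h1, h2, rfl⟩
    interval_cases q <;> interval_cases r
    · exact Or.inl ⟨0, by simp⟩
    · exact Or.inl ⟨1, by simp⟩
    · exact Or.inr rfl

theorem Fin.sum_single_castSucc_apply {n : ℕ} (q : Fin n → ℕ) (i : Fin (n + 1)) :
    (∑ j, Finsupp.single j.castSucc (q j)) i = Fin.snoc (α := fun _ => ℕ) q 0 i := by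
  classical
  rw [Finsupp.finsetSum_apply]
  refine Fin.lastCases ?_ (fun k => ?_) i
  · simp
  · simp [Finsupp.single_apply]

theorem Fin.sum_single_succ_apply {n : ℕ} (q : Fin n → ℕ) (i : Fin (n + 1)) :
    (∑ j, Finsupp.single j.succ (q j)) i = Fin.cons (α := fun _ => ℕ) 0 q i := by
  classical
  rw [Finsupp.finsetSum_apply]
  refine Fin.cases ?_ (fun k => ?_) i
  · simp
  · simp [Finsupp.single_apply]

/-- Here `p` records the choices in the binomials; in the `j`-th trinomial, `(q j, r j)` is `(0,0)`,
`(1,0)` or `(1,1)`, contributing to coordinates `j` and `j + 1`. -/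
theorem mem_support_pellPolynomial {n : ℕ} (m : Fin (n + 1) →₀ ℕ) :
    m ∈ (pellPolynomial (n + 1)).support ↔
      ∃ (p : Fin (n + 1) → ℕ) (q r : Fin n → ℕ), (∀ i, p i ≤ 1) ∧ (∀ j, r j ≤ q j) ∧
        (∀ j, q j ≤ 1) ∧
        ∀ i, m i = p i + Fin.snoc (α := fun _ => ℕ) q 0 i + Fin.cons (α := fun _ => ℕ) 0 r i := by
  classical
  have hmap : pellPolynomial (n + 1) = MvPolynomial.map (Nat.castRingHom ℤ)
      ((∏ i : Fin (n + 1), (1 + MvPolynomial.X i)) *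
        ∏ j : Fin n, (1 + MvPolynomial.X j.castSucc
          + MvPolynomial.X j.castSucc * MvPolynomial.X j.succ)) := by
    simp only [map_mul, map_prod, map_add, map_one, MvPolynomial.map_X]
    rfl
  rw [hmap, MvPolynomial.support_map_of_injective _ Nat.cast_injective, ← Finset.mem_coe,
    MvPolynomial.support_mul_nat, MvPolynomial.support_prod_nat, MvPolynomial.support_prod_nat,
    Set.mem_add]
  simp only [Set.mem_fintype_sum, Finset.mem_coe, MvPolynomial.mem_support_one_add_X,
    MvPolynomial.mem_support_one_add_X_add_X_mul_X]
  constructor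
  · rintro ⟨_, ⟨f, hf, rfl⟩, _, ⟨g, hg, rfl⟩, rfl⟩
    choose p hp hfp using hf
    choose q r hr hq hg using hg
    refine ⟨p, q, r, hp, hr, hq, fun i => ?_⟩
    simp only [hfp, hg, Finset.sum_add_distrib, Finsupp.add_apply,
      Fin.sum_single_castSucc_apply, Fin.sum_single_succ_apply]
    simp [Finsupp.finsetSum_apply, Finsupp.single_apply, add_assoc]
  · rintro ⟨p, q, r, hp, hr, hq, hm⟩
    refine ⟨_, ⟨fun i => Finsupp.single i (p i), fun i => ⟨p i, hp i, rfl⟩, rfl⟩, _,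
      ⟨fun j => Finsupp.single j.castSucc (q j) + Finsupp.single j.succ (r j),
        fun j => ⟨q j, r j, hr j, hq j, rfl⟩, rfl⟩, ?_⟩
    ext i
    simp only [Finset.sum_add_distrib, Finsupp.add_apply,
      Fin.sum_single_castSucc_apply, Fin.sum_single_succ_apply, hm]
    simp [Finsupp.finsetSum_apply, Finsupp.single_apply, add_assoc]

end Support
-- Words for the maximal cones
/-- The four local patterns of a maximal cone of the normal fan of the pellytope at a coordinate:
the outer normals `-e_i` (`neg`), `e_i` (`pos`), `e_i - e_{i-1}` (`diffPrev`) and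
`e_{i+1} - e_i` (`diffNext`). -/
inductive PellLetter
  | neg
  | pos
  | diffPrev
  | diffNext
  deriving DecidableEq

namespace PellLetter

instance : Fintype PellLetter :=
  ⟨{neg, pos, diffPrev, diffNext}, fun a => by cases a <;> decide⟩

/-- The admissible transitions between neighbouring coordinates. -/
def Follows (a b : PellLetter) : Prop :=
  (b = diffPrev → a = neg) ∧ (a = diffNext → b = pos) ∧ ¬(a = neg ∧ b = pos)

instance : DecidableRel Follows := fun a b => by unfold Follows; infer_instance

end PellLetter

open PellLetter in
/-- The words encoding the maximal cones of the normal fan of the pellytope. -/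
structure IsPellWord {n : ℕ} (w : Fin (n + 1) → PellLetter) : Prop where
  zero : w 0 ≠ diffPrev
  last : w (Fin.last n) ≠ diffNext
  follows : ∀ j : Fin n, Follows (w j.castSucc) (w j.succ)

/-! ### Counting words by the Pell recursion -/

section Count

open PellLetter

/-- The words that may follow the letter `l` and do not end in `diffNext`. -/
def IsPellTail {n : ℕ} (l : PellLetter) (w : Fin n → PellLetter) : Prop :=
  (∀ j : Fin n, Follows (Fin.cons (α := fun _ => PellLetter) l w j.castSucc) (w j)) ∧
    Fin.cons (α := fun _ => PellLetter) l w (Fin.last n) ≠ diffNext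

instance {n : ℕ} (l : PellLetter) : DecidablePred (IsPellTail (n := n) l) := fun w => by
  unfold IsPellTail; infer_instance

theorem isPellTail_cons {n : ℕ} (l a : PellLetter) (w : Fin n → PellLetter) :
    IsPellTail l (Fin.cons (α := fun _ => PellLetter) a w) ↔ Follows l a ∧ IsPellTail a w := by
  unfold IsPellTail
  rw [Fin.forall_fin_succ, ← Fin.succ_last, Fin.cons_succ, and_assoc]
  simp only [Fin.castSucc_zero, Fin.cons_zero, Fin.cons_succ, ← Fin.succ_castSucc]

/-- A virtual initial `pos` forbids exactly `diffPrev` as the next letter, which is the condition at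
coordinate `0`. -/
theorem isPellWord_iff_isPellTail {n : ℕ} (w : Fin (n + 1) → PellLetter) :
    IsPellWord w ↔ IsPellTail pos w := by
  have h0 : ∀ a, Follows pos a ↔ a ≠ diffPrev := by decide
  unfold IsPellTail
  rw [Fin.forall_fin_succ, ← Fin.succ_last, Fin.cons_succ, and_assoc]
  simp only [Fin.castSucc_zero, Fin.cons_zero, Fin.cons_succ, ← Fin.succ_castSucc, h0]
  exact ⟨fun ⟨h1, h2, h3⟩ => ⟨h1, h3, h2⟩, fun ⟨h1, h3, h2⟩ => ⟨h1, h2, h3⟩⟩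

def pellTailEquiv (n : ℕ) (l : PellLetter) :
    {w : Fin (n + 1) → PellLetter // IsPellTail l w} ≃
      Σ a : {a // Follows l a}, {w : Fin n → PellLetter // IsPellTail a.1 w} where
  toFun w :=
    have h := (isPellTail_cons l (w.1 0) (Fin.tail w.1)).1 ((Fin.cons_self_tail w.1).symm ▸ w.2)
    ⟨⟨w.1 0, h.1⟩, ⟨Fin.tail w.1, h.2⟩⟩
  invFun x := ⟨Fin.cons x.1.1 x.2.1, (isPellTail_cons _ _ _).2 ⟨x.1.2, x.2.2⟩⟩
  left_inv w := Subtype.ext (Fin.cons_self_tail w.1)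
  right_inv _ := rfl

theorem card_pellTail_succ (n : ℕ) (l : PellLetter) :
    Fintype.card {w : Fin (n + 1) → PellLetter // IsPellTail l w} =
      ∑ a, if Follows l a then Fintype.card {w : Fin n → PellLetter // IsPellTail a w} else 0 := by
  rw [Fintype.card_congr (pellTailEquiv n l), Fintype.card_sigma, ← Finset.sum_filter]
  exact (Finset.sum_subtype (Finset.univ.filter (Follows l)) (by simp)
    fun a => Fintype.card {w : Fin n → PellLetter // IsPellTail a w}).symm

theorem card_pellTail_zero (l : PellLetter) :
    Fintype.card {w : Fin 0 → PellLetter // IsPellTail l w} = if l = diffNext then 0 else 1 := by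
  cases l <;> decide

theorem sum_pellLetter (f : PellLetter → ℕ) :
    ∑ a, f a = f neg + f pos + f diffPrev + f diffNext := by
  have : (Finset.univ : Finset PellLetter) = {neg, pos, diffPrev, diffNext} := rfl
  rw [this]
  simp [add_assoc]

/-- Only `pos` follows `diffNext`. Any other letter has three successors, `diffNext` and two others,
which gives `2 * pellNumber (n + 1) + pellNumber n`. -/
theorem card_pellTail (n : ℕ) :
    Fintype.card {w : Fin n → PellLetter // IsPellTail neg w} = pellNumber (n + 1) ∧
    Fintype.card {w : Fin n → PellLetter // IsPellTail pos w} = pellNumber (n + 1) ∧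
    Fintype.card {w : Fin n → PellLetter // IsPellTail diffPrev w} = pellNumber (n + 1) ∧
    Fintype.card {w : Fin n → PellLetter // IsPellTail diffNext w} = pellNumber n := by
  induction n with
  | zero => simp [card_pellTail_zero, pellNumber]
  | succ n ih =>
    obtain ⟨h1, h2, h3, h4⟩ := ih
    simp only [card_pellTail_succ, sum_pellLetter, h1, h2, h3, h4]
    simp [Follows, pellNumber]
    omega

theorem card_isPellWord (n : ℕ) :
    Nat.card {w : Fin (n + 1) → PellLetter // IsPellWord w} = pellNumber (n + 2) := by
  simp only [isPellWord_iff_isPellTail, Nat.card_eq_fintype_card]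
  exact (card_pellTail (n + 1)).2.1

end Count
-- The normal fan of the pellytope
section Fan

open PellLetter

variable {n : ℕ}

/-- The outer normals `e_i`, `-e_i`, `e_{j+1} - e_j` of the facets of the pellytope. -/
def pellRay : Fin (n + 1) ⊕ Fin (n + 1) ⊕ Fin n → (Fin (n + 1) → ℝ) →L[ℝ] ℝ
  | .inl i => ContinuousLinearMap.proj i
  | .inr (.inl i) => -ContinuousLinearMap.proj i
  | .inr (.inr j) =>
    ContinuousLinearMap.proj (R := ℝ) (φ := fun _ => ℝ) j.succ
      - ContinuousLinearMap.proj (R := ℝ) (φ := fun _ => ℝ) j.castSucc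

/-- The indicator of the coordinates that have a successor. -/
def hasNext (i : Fin (n + 1)) : ℕ := Fin.snoc (α := fun _ => ℕ) (fun _ => 1) 0 i

/-- The indicator of the coordinates that have a predecessor. -/
def hasPrev (i : Fin (n + 1)) : ℕ := Fin.cons (α := fun _ => ℕ) 0 (fun _ => 1) i

@[simp] theorem hasNext_castSucc (j : Fin n) : hasNext j.castSucc = 1 := by simp [hasNext]
@[simp] theorem hasNext_last : hasNext (Fin.last n) = 0 := by simp [hasNext]
@[simp] theorem hasPrev_succ (j : Fin n) : hasPrev j.succ = 1 := by simp [hasPrev]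
@[simp] theorem hasPrev_zero : hasPrev (0 : Fin (n + 1)) = 0 := by simp [hasPrev]

/-- The right-hand sides of the facet inequalities of the pellytope. -/
def pellBound : Fin (n + 1) ⊕ Fin (n + 1) ⊕ Fin n → ℕ
  | .inl i => 1 + hasNext i + hasPrev i
  | .inr (.inl _) => 0
  | .inr (.inr j) => 1 + hasNext j.succ

/-- The `i`-th generator of the cone encoded by a word. -/
def pellCone (w : Fin (n + 1) → PellLetter) (i : Fin (n + 1)) :
    Fin (n + 1) ⊕ Fin (n + 1) ⊕ Fin n :=
  match w i with
  | neg => .inr (.inl i)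
  | pos => .inl i
  -- The boundary values `.inl i` here and below are placeholders: a Pell word neither begins with
  -- `diffPrev` nor ends with `diffNext`.
  | diffPrev => Fin.cons (α := fun _ => Fin (n + 1) ⊕ Fin (n + 1) ⊕ Fin n) (.inl i)
      (fun j => .inr (.inr j)) i
  | diffNext => Fin.snoc (α := fun _ => Fin (n + 1) ⊕ Fin (n + 1) ⊕ Fin n)
      (fun j => .inr (.inr j)) (.inl i) i

/-- The coordinates of the vertex belonging to a word. -/
def pellVert (w : Fin (n + 1) → PellLetter) (i : Fin (n + 1)) : ℕ :=
  match w i with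
  | neg => 0
  | pos => 1 + hasNext i + hasPrev i
  | diffPrev => 1 + hasNext i
  | diffNext => 1

/-- The point at which the generators of the cone of a word take prescribed values. -/
def pellSolve (w : Fin (n + 1) → PellLetter) (t : Fin (n + 1) → ℝ) (i : Fin (n + 1)) : ℝ :=
  match w i with
  | neg => -t i
  | pos => t i
  | diffPrev => Fin.cons (α := fun _ => ℝ) 0 (fun j => t j.succ - t j.castSucc) i
  | diffNext => Fin.snoc (α := fun _ => ℝ) (fun j => t j.succ - t j.castSucc) 0 i

namespace IsPellWord

variable {w : Fin (n + 1) → PellLetter} (hw : IsPellWord w)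
include hw

theorem exists_succ {i : Fin (n + 1)} (hi : w i = diffPrev) :
    ∃ j : Fin n, i = j.succ ∧ w j.castSucc = neg := by
  induction i using Fin.cases with
  | zero => exact absurd hi hw.zero
  | succ j => exact ⟨j, rfl, (hw.follows j).1 hi⟩

theorem exists_castSucc {i : Fin (n + 1)} (hi : w i = diffNext) :
    ∃ j : Fin n, i = j.castSucc ∧ w j.succ = pos := by
  induction i using Fin.lastCases with
  | last => exact absurd hi hw.last
  | cast j => exact ⟨j, rfl, (hw.follows j).2.1 hi⟩

theorem hasPrev_eq_one {i : Fin (n + 1)} (hi : w i = diffPrev) : hasPrev i = 1 := by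
  obtain ⟨j, rfl, -⟩ := hw.exists_succ hi
  simp

theorem hasNext_eq_one {i : Fin (n + 1)} (hi : w i = diffNext) : hasNext i = 1 := by
  obtain ⟨j, rfl, -⟩ := hw.exists_castSucc hi
  simp

/-- The neighbour of `diffPrev` is `neg` and that of `diffNext` is `pos`, so the system is
triangular in blocks of size at most two. Unit vectors for `t` yield the dual basis. -/
theorem ray_pellSolve (t : Fin (n + 1) → ℝ) (i : Fin (n + 1)) :
    pellRay (pellCone w i) (pellSolve w t) = t i := by
  cases hi : w i with
  | neg => simp [pellCone, hi, pellRay, pellSolve]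
  | pos => simp [pellCone, hi, pellRay, pellSolve]
  | diffPrev =>
    obtain ⟨j, rfl, hj⟩ := hw.exists_succ hi
    simp [pellCone, hi, pellRay, pellSolve, hj]
  | diffNext =>
    obtain ⟨j, rfl, hj⟩ := hw.exists_castSucc hi
    simp [pellCone, hi, pellRay, pellSolve, hj]

theorem ray_pellVert (i : Fin (n + 1)) :
    pellRay (pellCone w i) (fun i => (pellVert w i : ℝ)) = pellBound (pellCone w i) := by
  cases hi : w i with
  | neg => simp [pellCone, hi, pellRay, pellVert, pellBound]
  | pos => simp [pellCone, hi, pellRay, pellVert, pellBound]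
  | diffPrev =>
    obtain ⟨j, rfl, hj⟩ := hw.exists_succ hi
    simp [pellCone, hi, pellRay, pellVert, pellBound, hj]
  | diffNext =>
    obtain ⟨j, rfl, hj⟩ := hw.exists_castSucc hi
    simp [pellCone, hi, pellRay, pellVert, pellBound, hj]

theorem ray_pellVert_lt {a : Fin (n + 1) ⊕ Fin (n + 1) ⊕ Fin n}
    (ha : a ∉ Set.range (pellCone w)) :
    pellRay a (fun i => (pellVert w i : ℝ)) < pellBound a := by
  have ha : ∀ i, pellCone w i ≠ a := fun i h => ha ⟨i, h⟩
  match a with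
  | .inl i =>
    have key : pellVert w i < pellBound (.inl i) := by
      cases hi : w i with
      | neg => simp [hi, pellVert, pellBound, add_assoc]
      | pos => exact absurd (by simp [pellCone, hi]) (ha i)
      | diffPrev =>
        obtain ⟨j, rfl, hj⟩ := hw.exists_succ hi
        simp [hi, pellVert, pellBound]
      | diffNext =>
        obtain ⟨j, rfl, hj⟩ := hw.exists_castSucc hi
        simp [hi, pellVert, pellBound]
        omega
    simpa [pellRay] using (Nat.cast_lt (α := ℝ)).2 key
  | .inr (.inl i) =>
    have key : 0 < pellVert w i := by
      cases hi : w i with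
      | neg => exact absurd (by simp [pellCone, hi]) (ha i)
      | _ => simp [hi, pellVert, add_assoc]
    simpa [pellRay, pellBound] using key
  | .inr (.inr j) =>
    have h1 := ha j.succ
    have h2 := ha j.castSucc
    have h3 := hw.follows j
    have h4 : w j.succ = diffNext → hasNext j.succ = 1 := hw.hasNext_eq_one
    have key : pellVert w j.succ < pellBound (.inr (.inr j)) + pellVert w j.castSucc := by
      cases hs : w j.succ <;> cases hc : w j.castSucc <;>
        simp_all [pellCone, pellVert, pellBound, Follows] <;> try omega
    rw [← Nat.cast_lt (α := ℝ), Nat.cast_add] at key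
    simpa [pellRay, sub_lt_iff_lt_add] using key

/-- Each coordinate alone determines its letter: `diffPrev` forces a predecessor and `diffNext` a
successor, which separates the four values. -/
theorem eq_of_pellVert_eq {w' : Fin (n + 1) → PellLetter} (hw' : IsPellWord w')
    (h : pellVert w = pellVert w') : w = w' := by
  ext1 i
  have hi := congrFun h i
  cases h1 : w i <;> cases h2 : w' i <;> simp [pellVert, h1, h2, add_assoc] at hi ⊢
  all_goals
    have p1 := hw.hasPrev_eq_one (i := i)
    have p2 := hw'.hasPrev_eq_one (i := i)
    have n1 := hw.hasNext_eq_one (i := i)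
    have n2 := hw'.hasNext_eq_one (i := i)
    simp only [h1, h2, forall_const] at p1 p2 n1 n2
    omega

end IsPellWord

/-- The word of the cone that contains the functional with coefficients `u`. -/
noncomputable def pellWord (u : Fin (n + 1) → ℝ) (i : Fin (n + 1)) : PellLetter :=
  open Classical in
  if 0 < u i then
    if ∃ j : Fin n, i = j.succ ∧ u j.castSucc ≤ 0 ∧ u j.castSucc + u j.succ ≤ 0 then diffPrev
    else pos
  else
    if ∃ j : Fin n, i = j.castSucc ∧ 0 < u j.succ ∧ 0 < u j.castSucc + u j.succ then diffNext
    else neg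

theorem pellWord_eq_diffPrev_iff (u : Fin (n + 1) → ℝ) (i : Fin (n + 1)) :
    pellWord u i = diffPrev ↔ 0 < u i ∧
      ∃ j : Fin n, i = j.succ ∧ u j.castSucc ≤ 0 ∧ u j.castSucc + u j.succ ≤ 0 := by
  unfold pellWord
  split_ifs <;> simp_all

theorem pellWord_eq_diffNext_iff (u : Fin (n + 1) → ℝ) (i : Fin (n + 1)) :
    pellWord u i = diffNext ↔ u i ≤ 0 ∧
      ∃ j : Fin n, i = j.castSucc ∧ 0 < u j.succ ∧ 0 < u j.castSucc + u j.succ := by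
  unfold pellWord
  split_ifs <;> simp_all

theorem pellWord_eq_pos_iff (u : Fin (n + 1) → ℝ) (i : Fin (n + 1)) :
    pellWord u i = pos ↔ 0 < u i ∧
      ∀ j : Fin n, i = j.succ → u j.castSucc ≤ 0 → 0 < u j.castSucc + u j.succ := by
  unfold pellWord
  split_ifs <;> simp_all

theorem pellWord_eq_neg_iff (u : Fin (n + 1) → ℝ) (i : Fin (n + 1)) :
    pellWord u i = neg ↔ u i ≤ 0 ∧
      ∀ j : Fin n, i = j.castSucc → 0 < u j.succ → u j.castSucc + u j.succ ≤ 0 := by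
  unfold pellWord
  split_ifs <;> simp_all

theorem isPellWord_pellWord (u : Fin (n + 1) → ℝ) : IsPellWord (pellWord u) where
  zero h := by
    obtain ⟨-, j, hj, -⟩ := (pellWord_eq_diffPrev_iff u _).1 h
    exact (Fin.succ_ne_zero j) hj.symm
  last h := by
    obtain ⟨-, j, hj, -⟩ := (pellWord_eq_diffNext_iff u _).1 h
    exact (Fin.castSucc_ne_last j) hj.symm
  follows j := by
    refine ⟨fun h => ?_, fun h => ?_, fun ⟨h1, h2⟩ => ?_⟩
    · obtain ⟨-, k, hk, h1, h2⟩ := (pellWord_eq_diffPrev_iff u _).1 h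
      obtain rfl := Fin.succ_injective _ hk
      refine (pellWord_eq_neg_iff u _).2 ⟨h1, fun k hk _ => ?_⟩
      obtain rfl := Fin.castSucc_injective _ hk
      exact h2
    · obtain ⟨-, k, hk, h1, h2⟩ := (pellWord_eq_diffNext_iff u _).1 h
      obtain rfl := Fin.castSucc_injective _ hk
      refine (pellWord_eq_pos_iff u _).2 ⟨h1, fun k hk _ => ?_⟩
      obtain rfl := Fin.succ_injective _ hk
      exact h2
    · rw [pellWord_eq_neg_iff] at h1
      rw [pellWord_eq_pos_iff] at h2
      exact absurd (h1.2 j rfl h2.1) (h2.2 j rfl h1.1).not_ge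

/-! ### Completeness of the fan -/

theorem Fin.sum_cons_zero_eq_sum_snoc_zero (f : Fin n → ℝ) :
    ∑ i, Fin.cons (α := fun _ => ℝ) 0 f i = ∑ i, Fin.snoc (α := fun _ => ℝ) f 0 i := by
  rw [Fin.sum_univ_succ, Fin.sum_univ_castSucc]
  simp

/-- A functional is nonnegative on the dual cone of the cone that contains it. -/
theorem sum_mul_nonneg_of_pellWord (u y : Fin (n + 1) → ℝ)
    (hy : ∀ i, 0 ≤ pellRay (pellCone (pellWord u) i) y) : 0 ≤ ∑ i, u i * y i := by
  set w := pellWord u with hwu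
  have hw : IsPellWord w := isPellWord_pellWord u
  -- `φ j` is an amount moved between coordinates `j` and `j + 1` of an ascent. It reduces the two
  -- terms to the sign of `u_j + u_{j+1}` times `y_j` (for `neg`, `diffPrev`) or `y_{j+1}` (for
  -- `diffNext`, `pos`). All transfers cancel in the sum.
  let φ : Fin n → ℝ := fun j =>
    if w j.succ = diffPrev then u j.succ * y j.castSucc
    else if w j.castSucc = diffNext then -(u j.castSucc * y j.succ) else 0
  let α : Fin (n + 1) → ℝ := fun i => Fin.cons (α := fun _ => ℝ) 0 φ i
  let β : Fin (n + 1) → ℝ := fun i => Fin.snoc (α := fun _ => ℝ) φ 0 i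
  have hαs : ∀ j, α j.succ = φ j := fun j => by simp [α]
  have hβc : ∀ j, β j.castSucc = φ j := fun j => by simp [β]
  have hα0 : ∀ i, w i = neg ∨ w i = diffNext → α i = 0 := by
    intro i hi
    induction i using Fin.cases with
    | zero => simp [α]
    | succ j =>
      have := hw.follows j
      rw [hαs]
      rcases hi with hi | hi <;> simp_all [φ, Follows]
  have hβ0 : ∀ i, w i = pos ∨ w i = diffPrev → β i = 0 := by
    intro i hi
    induction i using Fin.lastCases with
    | last => simp [β]
    | cast j =>
      have := hw.follows j
      rw [hβc]
      rcases hi with hi | hi <;> simp_all [φ, Follows]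
  have key : ∀ i, α i - β i ≤ u i * y i := by
    intro i
    have hyi := hy i
    cases hi : w i with
    | neg =>
      have hyi : y i ≤ 0 := by simpa [pellCone, hi, pellRay] using hyi
      obtain ⟨h1, h2⟩ := (pellWord_eq_neg_iff u i).1 hi
      rw [hα0 i (Or.inl hi)]
      induction i using Fin.lastCases with
      | last =>
        simp only [β, Fin.snoc_last, sub_zero]
        exact mul_nonneg_of_nonpos_of_nonpos h1 hyi
      | cast j =>
        rw [hβc]
        simp only [φ, hi]
        rw [if_neg (show ¬neg = diffNext by simp)]
        split_ifs with h3
        · have h4 := h2 j rfl ((pellWord_eq_diffPrev_iff u _).1 h3).1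
          nlinarith
        · simpa using mul_nonneg_of_nonpos_of_nonpos h1 hyi
    | pos =>
      have hyi : 0 ≤ y i := by simpa [pellCone, hi, pellRay] using hyi
      obtain ⟨h1, h2⟩ := (pellWord_eq_pos_iff u i).1 hi
      rw [hβ0 i (Or.inl hi)]
      induction i using Fin.cases with
      | zero =>
        simp only [α, Fin.cons_zero, sub_zero]
        exact mul_nonneg h1.le hyi
      | succ j =>
        rw [hαs]
        simp only [φ, hi]
        rw [if_neg (show ¬pos = diffPrev by simp)]
        split_ifs with h3
        · have h4 := h2 j rfl ((pellWord_eq_diffNext_iff u _).1 h3).1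
          nlinarith
        · simpa using mul_nonneg h1.le hyi
    | diffPrev =>
      obtain ⟨j, rfl, hj⟩ := hw.exists_succ hi
      have hyi : y j.castSucc ≤ y j.succ := by simpa [pellCone, hi, pellRay] using hyi
      rw [hβ0 _ (Or.inr hi), hαs, sub_zero]
      simp only [φ, hi, if_true]
      exact mul_le_mul_of_nonneg_left hyi ((pellWord_eq_diffPrev_iff u _).1 hi).1.le
    | diffNext =>
      obtain ⟨j, rfl, hj⟩ := hw.exists_castSucc hi
      have hyi : y j.castSucc ≤ y j.succ := by simpa [pellCone, hi, pellRay] using hyi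
      rw [hα0 _ (Or.inr hi), hβc]
      have := mul_le_mul_of_nonpos_left hyi ((pellWord_eq_diffNext_iff u _).1 hi).1
      simpa [φ, hi, hj] using this
  have hsum : ∑ i, (α i - β i) = 0 := by
    rw [Finset.sum_sub_distrib, sub_eq_zero]
    exact Fin.sum_cons_zero_eq_sum_snoc_zero φ
  rw [← hsum]
  exact Finset.sum_le_sum fun i _ => key i

theorem exists_pellCone (a : Fin (n + 1) ⊕ Fin (n + 1) ⊕ Fin n) :
    ∃ (w : {w : Fin (n + 1) → PellLetter // IsPellWord w}) (i : Fin (n + 1)),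
      pellCone w.1 i = a := by
  match a with
  | .inl i => exact ⟨⟨fun _ => pos, by simp, by simp, by simp [Follows]⟩, i, by simp [pellCone]⟩
  | .inr (.inl i) =>
    exact ⟨⟨fun _ => neg, by simp, by simp, by simp [Follows]⟩, i, by simp [pellCone]⟩
  | .inr (.inr j) =>
    -- The word is `neg … neg diffPrev pos … pos`, with `diffPrev` at `j + 1`.
    refine ⟨⟨fun i => if i = j.succ then diffPrev else if i < j.succ then neg else pos,
      ?_, ?_, fun k => ?_⟩, j.succ, by simp [pellCone]⟩
    · simp [(Fin.succ_ne_zero j).symm]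
    · split_ifs <;> simp
    · simp only [Fin.ext_iff, Fin.lt_def, Fin.val_succ, Fin.val_castSucc, Follows]
      split_ifs <;> simp <;> omega

/-- The normal fan of the pellytope. -/
def pellFan (n : ℕ) :
    SimplicialNormalFan {x : Fin (n + 1) → ℝ | ∀ a, pellRay a x ≤ (pellBound a : ℝ)}
      (Fin (n + 1) ⊕ Fin (n + 1) ⊕ Fin n)
      {w : Fin (n + 1) → PellLetter // IsPellWord w} (Fin (n + 1)) where
  ray := pellRay
  h a := pellBound a
  cone w := pellCone w.1
  vert w i := pellVert w.1 i
  b w j := pellSolve w.1 (Pi.single j 1)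
  eq_halfSpaces := rfl
  ray_b w i j := by rw [w.2.ray_pellSolve, Pi.single_apply]
  complete u := by
    let c : Fin (n + 1) → ℝ := fun i => u (Pi.single i 1)
    have hw := isPellWord_pellWord c
    refine ⟨⟨pellWord c, hw⟩, fun j => ?_⟩
    have hu : ∀ y, u y = ∑ i, c i * y i := by
      intro y
      refine (LinearMap.pi_apply_eq_sum_univ (u : (Fin (n + 1) → ℝ) →ₗ[ℝ] ℝ) y).trans ?_
      have hs : ∀ i : Fin (n + 1), (fun j => if i = j then (1 : ℝ) else 0) = Pi.single i 1 :=
          fun i => by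
            ext j
            simp [Pi.single_apply, eq_comm]
      simp [c, mul_comm, hs]
    rw [hu]
    -- On a dual basis vector the generators take values `0` and `1`, so it lies in the dual cone.
    refine sum_mul_nonneg_of_pellWord c _ fun i => ?_
    rw [hw.ray_pellSolve, Pi.single_apply]
    split_ifs <;> simp
  tight w j := w.2.ray_pellVert j
  strict w a ha := w.2.ray_pellVert_lt ha
  exists_cone := exists_pellCone
  vert_injective w w' h := Subtype.ext <| w.2.eq_of_pellVert_eq w'.2 <| by
    ext i
    exact Nat.cast_injective (congrFun h i)

end Fan

/-! ### The Newton polytope as the polyhedron of the fan -/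

section Main

open PellLetter

variable {n : ℕ}

theorem exponents_le {m : Fin (n + 1) →₀ ℕ} (hm : m ∈ (pellPolynomial (n + 1)).support)
    (a : Fin (n + 1) ⊕ Fin (n + 1) ⊕ Fin n) :
    pellRay a (fun i => (m i : ℝ)) ≤ pellBound a := by
  obtain ⟨p, q, r, hp, hr, hq, hm⟩ := (mem_support_pellPolynomial m).1 hm
  have hsnoc : ∀ i, Fin.snoc (α := fun _ => ℕ) q 0 i ≤ hasNext i := by
    intro i
    induction i using Fin.lastCases <;> simp [hq]
  have hcons : ∀ i, Fin.cons (α := fun _ => ℕ) 0 r i ≤ hasPrev i := by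
    intro i
    induction i using Fin.cases
    · simp
    · simpa using (hr _).trans (hq _)
  match a with
  | .inl i =>
    have key : m i ≤ pellBound (.inl i) := by
      have h1 := hsnoc i
      have h2 := hcons i
      have h3 := hp i
      have h4 := hm i
      simp only [pellBound]
      omega
    simpa [pellRay] using (Nat.cast_le (α := ℝ)).2 key
  | .inr (.inl i) => simp [pellRay, pellBound]
  | .inr (.inr j) =>
    -- The contribution `r j` to coordinate `j + 1` is paid for by `q j` in coordinate `j`.
    have key : m j.succ ≤ pellBound (.inr (.inr j)) + m j.castSucc := by
      have h1 := hsnoc j.succ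
      have h2 := hm j.succ
      have h3 := hm j.castSucc
      have h4 := hp j.succ
      have h5 := hr j
      simp only [pellBound, Fin.snoc_castSucc, Fin.cons_succ] at h2 h3 ⊢
      omega
    rw [← Nat.cast_le (α := ℝ), Nat.cast_add] at key
    simpa [pellRay, sub_le_iff_le_add] using key

theorem IsPellWord.pellVert_mem_support {w : Fin (n + 1) → PellLetter} (hw : IsPellWord w) :
    Finsupp.equivFunOnFinite.symm (pellVert w) ∈ (pellPolynomial (n + 1)).support := by
  refine (mem_support_pellPolynomial _).2
    -- In each factor, choose the monomial maximizing the functionals in the cone of `w`. The ban on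
    -- `neg` before `pos` gives `r ≤ q`.
    ⟨fun i => if w i = pos ∨ w i = diffPrev then 1 else 0,
      fun j => if w j.castSucc = neg then 0 else 1,
      fun j => if w j.succ = pos then 1 else 0, fun i => ?_, fun j => ?_, fun j => ?_, fun i => ?_⟩
  · dsimp only
    split_ifs <;> simp
  · have := hw.follows j
    dsimp only
    split_ifs with h1 h2 <;> simp_all [Follows]
  · dsimp only
    split_ifs <;> simp
  · have hs : Fin.snoc (α := fun _ => ℕ) (fun j : Fin n => if w j.castSucc = neg then 0 else 1) 0 i
        = if w i = neg then 0 else hasNext i := by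
      induction i using Fin.lastCases <;> simp
    have hc : Fin.cons (α := fun _ => ℕ) 0 (fun j : Fin n => if w j.succ = pos then 1 else 0) i
        = if w i = pos then hasPrev i else 0 := by
      induction i using Fin.cases <;> simp
    rw [hs, hc, Finsupp.equivFunOnFinite_symm_apply_apply]
    cases hi : w i with
    | diffNext =>
      obtain ⟨j, rfl, -⟩ := hw.exists_castSucc hi
      simp [pellVert, hi]
    | _ => simp [pellVert, hi]

/-- By completeness of the fan, each functional has a maximum over the polyhedron at some
`pellVert`, which is an exponent. -/
theorem pellytope_eq_halfSpaces (n : ℕ) :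
    pellytope (n + 1) = {x | ∀ a, pellRay a x ≤ (pellBound a : ℝ)} := by
  refine convexHull_eq_halfSpaces ((Finset.finite_toSet _).image _) pellRay _ ?_ fun u => ?_
  · rintro _ ⟨m, hm, rfl⟩ a
    exact exponents_le hm a
  · obtain ⟨w, hw⟩ := (pellFan n).complete u
    refine ⟨(pellFan n).vert w, ⟨_, w.2.pellVert_mem_support, ?_⟩,
      fun x hx => (pellFan n).functional_le_vert (by simp) hw hx⟩
    simp [pellFan]

theorem isPolytope_pellytope (n : ℕ) : IsPolytope (pellytope (n + 1)) := by
  classical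
  have hne : (pellPolynomial (n + 1)).support.Nonempty :=
    ⟨_, (isPellWord_pellWord 0).pellVert_mem_support⟩
  refine ⟨(pellPolynomial (n + 1)).support.image fun m i => (m i : ℝ), hne.image _, ?_⟩
  rw [Finset.coe_image]
  rfl

theorem mainTheorem4 (d : ℕ) (hd : 1 ≤ d) :
    IsSimplePolytope (pellytope d) ∧
      convexDim (pellytope d) = d ∧
      ((polytopeFacets (pellytope d)).Finite ∧
        (polytopeFacets (pellytope d)).ncard = 3 * d - 1) ∧
      ((polytopeVertices (pellytope d)).Finite ∧
        (polytopeVertices (pellytope d)).ncard = pellNumber (d + 1)) := by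
  obtain ⟨n, rfl⟩ := Nat.exists_eq_add_of_le' hd
  have hpoly := isPolytope_pellytope n
  rw [pellytope_eq_halfSpaces] at hpoly ⊢
  have hJ : Fintype.card (Fin (n + 1)) = Module.finrank ℝ (Fin (n + 1) → ℝ) := by simp
  have hF := (pellFan n).ncard_polytopeFacets hJ
  have hV := (pellFan n).ncard_polytopeVertices hJ
  refine ⟨(pellFan n).isSimplePolytope hJ hpoly, ?_, ⟨hF.1, ?_⟩, hV.1, ?_⟩
  · rw [(pellFan n).convexDim_eq hJ ⟨_, isPellWord_pellWord 0⟩, Fintype.card_fin]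
  · rw [hF.2, Nat.card_eq_fintype_card]
    simp
    omega
  · rw [hV.2, card_isPellWord]

end Main
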